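/- Let $G$ be a finite non-abelian AC-group, that is, a finite non-abelian group, with center $Z(G)$, in which the centralizer $C_G(u)$ of every non-central element $u$ is abelian. Let $\Gamma_c(G)$ be the commuting graph of $G$: its vertex set is $G\setminus Z(G)$, and two distinct vertices $x,y$ are adjacent if and only if $xy=yx$. For a finite simple graph $\Gamma$ let $\gamma(\Gamma)$ be its genus, the smallest integer $n\ge 0$ such that $\Gamma$ can be embedded on the surface obtained by attaching $n$ handles to a sphere, and let $K_m$ be the complete graph on $m$ vertices. Then $$\gamma(\Gamma_c(G))=\sum_{X\in\mathcal P}\gamma(K_{|X|}),\qquad\text{where } \mathcal P=\{\,C_G(u)\setminus Z(G)\;:\;u\in G\setminus Z(G)\,\}$$ is a set, so that each distinct set $X$ is counted once. -/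

import Mathlib

/-- The commuting graph of a group `G`: its vertices are the non-central elements of `G`, and two
distinct vertices are adjacent if and only if they commute. -/
def commutingGraph (G : Type*) [Group G] : SimpleGraph {x : G // x ∉ Subgroup.center G} where
  Adj x y := x ≠ y ∧ (x : G) * y = y * x
  symm := ⟨fun _ _ h => ⟨h.1.symm, h.2.symm⟩⟩
  loopless := ⟨fun _ h => h.1 rfl⟩

/-- `G` is an AC-group if the centralizer of each of its non-central elements is abelian. -/
def IsACGroup (G : Type*) [Group G] : Prop :=
  ∀ u : G, u ∉ Subgroup.center G →
    ∀ x ∈ Subgroup.centralizer {u}, ∀ y ∈ Subgroup.centralizer {u}, x * y = y * x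

/-- The collection of the (distinct) sets `C_G(u) \ Z(G)`, where `u` runs over the non-central
elements of `G`. -/
def centralizerParts (G : Type*) [Group G] : Set (Set G) :=
  {X | ∃ u : G, u ∉ Subgroup.center G ∧
    X = (Subgroup.centralizer {u} : Set G) \ (Subgroup.center G : Set G)}

/-- A closed connected oriented surface together with a decomposition into finitely many polygons
(a cellular decomposition with at least one edge), given in the standard way as a combinatorial map.
A dart is an edge together with a direction; `flip` reverses the direction, and `next` sends
a dart to the next dart (in the positive sense) with the same initial vertex. The surface
is obtained by gluing one polygon along each orbit of `next * flip`. -/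
structure PolygonalSurface where
  Dart : Type
  finite : Finite Dart
  nonempty : Nonempty Dart
  next : Equiv.Perm Dart
  flip : Equiv.Perm Dart
  flip_flip : ∀ d, flip (flip d) = d
  flip_ne : ∀ d, flip d ≠ d
  connected : ∀ d e : Dart, ∃ g ∈ Subgroup.closure {next, flip}, g d = e

namespace PolygonalSurface

/-- The vertices: orbits of `next`. -/
def Vertex (S : PolygonalSurface) : Type :=
  Quotient (Equiv.Perm.SameCycle.setoid S.next)

/-- The (undirected) edges: orbits of `flip`. -/
def Edge (S : PolygonalSurface) : Type :=
  Quotient (Equiv.Perm.SameCycle.setoid S.flip)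

/-- The faces (polygons): orbits of the permutation which takes a dart `d` to the dart following
`d` on the boundary of the face beside it, namely the one after `flip d` around the terminal
vertex of `d`. -/
def Face (S : PolygonalSurface) : Type :=
  Quotient (Equiv.Perm.SameCycle.setoid (S.next * S.flip))

/-- The initial vertex of a dart; the terminal vertex of `d` is `S.source (S.flip d)`. -/
def source (S : PolygonalSurface) (d : S.Dart) : S.Vertex :=
  Quotient.mk (Equiv.Perm.SameCycle.setoid S.next) d

/-- The Euler characteristic `V - E + F`. -/
noncomputable def eulerChar (S : PolygonalSurface) : ℤ :=
  (Nat.card S.Vertex : ℤ) - Nat.card S.Edge + Nat.card S.Face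

end PolygonalSurface

/-- The graph `Γ` can be embedded on the sphere with `n` handles, that is, on the closed connected
orientable surface of Euler characteristic `2 - 2 n`: some polygonal decomposition of this surface
contains `Γ` in its 1-skeleton. The map on vertices is injective and `Γ` is simple, so distinct
edges of `Γ` are drawn along distinct edges of the decomposition. The 1-skeleton may have further
vertices and edges, so neither `Γ` nor the regions into which it cuts the surface need be
connected or simply connected. -/
def EmbedsOnSphereWithHandles {V : Type*} (Γ : SimpleGraph V) (n : ℕ) : Prop :=
  ∃ S : PolygonalSurface, S.eulerChar = 2 - 2 * (n : ℤ) ∧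
    ∃ f : V → S.Vertex, Function.Injective f ∧
      ∀ u v : V, Γ.Adj u v → ∃ d : S.Dart, S.source d = f u ∧ S.source (S.flip d) = f v

/-- The genus of a (finite) graph: the smallest `n` such that the graph can be embedded on the
sphere with `n` handles. Such an `n` exists for every finite graph. -/
noncomputable def graphGenus {V : Type*} (Γ : SimpleGraph V) : ℕ :=
  sInf {n : ℕ | EmbedsOnSphereWithHandles Γ n}

/-!
The commuting graph of an AC-group is the disjoint union of complete graphs on the sets
`C_G(u) \ Z(G)`: if every centralizer of a non-central element is abelian, then two non-central
elements commute if and only if they have the same centralizer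
(`IsACGroup.centralizer_sdiff_eq_iff`). So the claim is an instance of the additivity of the genus
over disjoint unions (`CombinatorialMap.graphGenus_eq_sum`).

Surfaces are handled through pairs `(σ, α)` of permutations of a finite set `D` of darts, where `α`
is an involution. The group generated by `σ` and `α` may be intransitive (a disconnected surface)
and `α` may have fixed points (half-edges with a free end). To such a pair belongs its `defect`,
twice the sum of the genera of its components, as given by the Euler characteristic. All is
controlled by multiplication with a single transposition, which changes the number of cycles of
a permutation by exactly one, up or down according to whether its two points lie in one cycle
(`numClasses_mul_swap_of_sameCycle`, `numClasses_mul_swap_of_not_sameCycle`). It follows that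

* joining two components by a transposition keeps the defect (`defect_mul_swap_of_not_rel`,
  `defect_swap_mul_of_not_rel`);
* deleting edges, that is, replacing pairs of darts of `α` by fixed points, does not increase the
  defect (`defect_le_of_forall_eq_or_eq`); deleting all of them shows that the defect is
  nonnegative, and the sign of a permutation shows that it is even;
* the defect is additive over invariant parts of `D` (`defect_eq_sum`).

If a graph is drawn on a pair `(σ, α)` of defect `2 n`, then it embeds on the sphere with `n`
handles: components can be joined by new edges, and half-edges can be closed by new vertices,
without changing the defect (`DrawnOn.embeds`). Hence a disjoint union of surfaces gives
`genus ≤ sum of genera` (`embeds_sum`). Conversely, deleting from a surface which carries the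
union all edges that do not join vertices of the same part makes the set of darts fall apart into
invariant pieces which carry the parts, and the sum of the defects of the pieces is at most the
defect of the surface (`sum_graphGenus_le`).
-/

namespace CombinatorialMap

open Equiv Equiv.Perm

universe u

/-! ### Orbits of permutation groups and multiplication by a transposition -/

section Orbits

variable {D : Type*}

/-- The partition of `D` into the orbits of the group generated by a set `A` of permutations. -/
def orbitSetoid (A : Set (Perm D)) : Setoid D where
  r x y := ∃ g ∈ Subgroup.closure A, g x = y
  iseqv :=
    ⟨fun _ => ⟨1, one_mem _, rfl⟩,
      fun ⟨g, hg, h⟩ => ⟨g⁻¹, inv_mem hg, by simp [← h]⟩,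
      fun ⟨g, hg, h⟩ ⟨k, hk, h'⟩ => ⟨k * g, mul_mem hk hg, by simp [h, h']⟩⟩

/-- The number of classes of an equivalence relation (`0` if there are infinitely many). -/
noncomputable def numClasses (s : Setoid D) : ℕ := Nat.card (Quotient s)

lemma orbitSetoid_of_mem {A : Set (Perm D)} {g : Perm D} (hg : g ∈ A) (x : D) :
    orbitSetoid A x (g x) :=
  ⟨g, Subgroup.subset_closure hg, rfl⟩

lemma orbitSetoid_le_iff {A : Set (Perm D)} {s : Setoid D} :
    orbitSetoid A ≤ s ↔ ∀ g ∈ A, ∀ x, s x (g x) := by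
  constructor
  · intro h g hg x
    exact h (orbitSetoid_of_mem hg x)
  · rintro h x y ⟨g, hg, rfl⟩
    suffices ∀ x, s x (g x) from this x
    induction hg using Subgroup.closure_induction with
    | mem g hg => exact h g hg
    | one => exact s.refl
    | mul g k _ _ ihg ihk => exact fun x => s.trans (ihk x) (ihg (k x))
    | inv g _ ih => exact fun x => by simpa using s.symm (ih (g⁻¹ x))

lemma orbitSetoid_union (A B : Set (Perm D)) :
    orbitSetoid (A ∪ B) = orbitSetoid A ⊔ orbitSetoid B := by
  apply le_antisymm
  · rw [orbitSetoid_le_iff]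
    rintro g (hg | hg) x
    · exact (le_sup_left : orbitSetoid A ≤ _) (orbitSetoid_of_mem hg x)
    · exact (le_sup_right : orbitSetoid B ≤ _) (orbitSetoid_of_mem hg x)
  · refine sup_le ?_ ?_ <;> rw [orbitSetoid_le_iff] <;> intro g hg x
    · exact orbitSetoid_of_mem (Or.inl hg) x
    · exact orbitSetoid_of_mem (Or.inr hg) x

lemma orbitSetoid_mono {A B : Set (Perm D)} (h : A ⊆ B) : orbitSetoid A ≤ orbitSetoid B := by
  rw [orbitSetoid_le_iff]
  exact fun g hg x => orbitSetoid_of_mem (h hg) x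

lemma orbitSetoid_congr {A B : Set (Perm D)} (h : Subgroup.closure A = Subgroup.closure B) :
    orbitSetoid A = orbitSetoid B := by
  ext x y
  change (∃ g ∈ Subgroup.closure A, g x = y) ↔ ∃ g ∈ Subgroup.closure B, g x = y
  rw [h]

lemma orbitSetoid_singleton (σ : Perm D) : orbitSetoid {σ} = SameCycle.setoid σ := by
  ext x y
  change (∃ g ∈ Subgroup.closure {σ}, g x = y) ↔ SameCycle σ x y
  simp [Subgroup.mem_closure_singleton, SameCycle]

lemma orbitSetoid_singleton_apply (σ : Perm D) (x y : D) :
    orbitSetoid {σ} x y ↔ SameCycle σ x y := by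
  rw [orbitSetoid_singleton]; rfl

lemma orbitSetoid_inv (σ : Perm D) : orbitSetoid {σ⁻¹} = orbitSetoid {σ} :=
  orbitSetoid_congr (by simp)

section Merge

variable [DecidableEq D]

lemma orbitSetoid_swap_le_iff {s : Setoid D} {a b : D} :
    orbitSetoid {swap a b} ≤ s ↔ s a b := by
  rw [orbitSetoid_le_iff]
  constructor
  · intro h
    simpa using h _ rfl a
  · rintro h _ rfl x
    by_cases ha : x = a
    · subst ha; simpa using h
    by_cases hb : x = b
    · subst hb; simpa using s.symm h
    rw [swap_apply_of_ne_of_ne ha hb]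

/-- Identifying two points of different classes lowers the number of classes by one. -/
lemma numClasses_sup_swap [Finite D] {s : Setoid D} {a b : D} (h : ¬ s a b) :
    numClasses (s ⊔ orbitSetoid {swap a b}) + 1 = numClasses s := by
  classical
  set t := s ⊔ orbitSetoid {swap a b}
  have hst : s ≤ t := le_sup_left
  have hab : t a b := orbitSetoid_swap_le_iff.mp le_sup_right
  -- `t` identifies no more than the map which sends the class of `b` to the class of `a`
  let φ : D → Quotient s := fun x => if s x b then ⟦a⟧ else ⟦x⟧
  have hφ : t ≤ Setoid.ker φ := by
    refine sup_le ?_ (orbitSetoid_swap_le_iff.mpr ?_)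
    · intro x y hxy
      change φ x = φ y
      have : s x b ↔ s y b := ⟨s.trans (s.symm hxy), s.trans hxy⟩
      simp only [φ, this]
      split_ifs
      · rfl
      · exact Quotient.sound hxy
    · change φ a = φ b
      simp [φ]
  let F : {q : Quotient s // q ≠ ⟦b⟧} → Quotient t :=
    fun q => Quotient.map id (fun _ _ h => hst h) q.1
  have hF : Function.Bijective F := by
    constructor
    · rintro ⟨q, hq⟩ ⟨q', hq'⟩
      induction q using Quotient.inductionOn with | _ x
      induction q' using Quotient.inductionOn with | _ y
      intro e
      have hx : ¬ s x b := fun h => hq (Quotient.sound h)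
      have hy : ¬ s y b := fun h => hq' (Quotient.sound h)
      have e' : t x y := Quotient.exact e
      have := hφ e'
      change φ x = φ y at this
      simp only [φ, hx, hy, if_false] at this
      exact Subtype.ext this
    · intro q
      induction q using Quotient.inductionOn with | _ x
      by_cases hx : s x b
      · refine ⟨⟨⟦a⟧, fun e => h (Quotient.exact e)⟩, ?_⟩
        exact Quotient.sound (t.trans hab (t.symm (hst hx)))
      · exact ⟨⟨⟦x⟧, fun e => hx (Quotient.exact e)⟩, rfl⟩
  unfold numClasses
  rw [← Nat.card_eq_of_bijective F hF, ← Finite.card_option]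
  exact Nat.card_congr (optionSubtypeNe (⟦b⟧ : Quotient s))

lemma sup_swap_eq_of_rel {s : Setoid D} {a b : D} (h : s a b) :
    s ⊔ orbitSetoid {swap a b} = s :=
  sup_eq_left.mpr (orbitSetoid_swap_le_iff.mpr h)

/-- Once `a` and `b` are identified, multiplying by `swap a b` makes no difference. -/
lemma orbitSetoid_insert_mul_swap_sup (A : Set (Perm D)) (σ : Perm D) (a b : D) :
    orbitSetoid (insert (σ * swap a b) A) ⊔ orbitSetoid {swap a b} =
      orbitSetoid (insert σ A) ⊔ orbitSetoid {swap a b} := by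
  rw [← orbitSetoid_union, ← orbitSetoid_union]
  apply orbitSetoid_congr
  apply le_antisymm <;> rw [Subgroup.closure_le] <;> rintro g ((rfl | hg) | hg)
  · exact mul_mem (Subgroup.subset_closure (by simp)) (Subgroup.subset_closure (by simp))
  · exact Subgroup.subset_closure (by simp [hg])
  · exact Subgroup.subset_closure (Or.inr hg)
  · have : g = (g * swap a b) * swap a b := by simp [mul_assoc]
    rw [this]
    exact mul_mem (Subgroup.subset_closure (by simp)) (Subgroup.subset_closure (by simp))
  · exact Subgroup.subset_closure (by simp [hg])
  · exact Subgroup.subset_closure (Or.inr hg)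

lemma sup_swap_mul_swap (σ : Perm D) (a b : D) :
    orbitSetoid {σ * swap a b} ⊔ orbitSetoid {swap a b} =
      orbitSetoid {σ} ⊔ orbitSetoid {swap a b} := by
  simpa using orbitSetoid_insert_mul_swap_sup ∅ σ a b

end Merge

section Parity

variable [Fintype D] [DecidableEq D]

/-- The orbits of `σ` are the supports of its nontrivial cycles and its fixed points. -/
lemma numClasses_orbitSetoid_singleton (σ : Perm D) :
    numClasses (orbitSetoid {σ}) + σ.support.card = σ.cycleType.card + Fintype.card D := by
  classical
  let F : D → σ.cycleFactorsFinset ⊕ {x // x ∉ σ.support} := fun x =>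
    if h : x ∈ σ.support then .inl ⟨σ.cycleOf x, cycleOf_mem_cycleFactorsFinset_iff.mpr h⟩
    else .inr ⟨x, h⟩
  have key : ∀ x y, SameCycle σ x y ↔ F x = F y := by
    intro x y
    by_cases hx : x ∈ σ.support
    · by_cases hy : y ∈ σ.support
      · simp only [F, hx, hy, dif_pos, Sum.inl.injEq, Subtype.mk.injEq]
        exact sameCycle_iff_cycleOf_eq_of_mem_support hx hy
      · simp only [F, hx, hy, dif_pos, dif_neg, not_false_iff, reduceCtorEq, iff_false]
        exact fun h => hy (by simpa [mem_support, h.apply_eq_self_iff] using hx)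
    · by_cases hy : y ∈ σ.support
      · simp only [F, hx, hy, dif_pos, dif_neg, not_false_iff, reduceCtorEq, iff_false]
        exact fun h => hx (by simpa [mem_support, h.apply_eq_self_iff] using hy)
      · simp only [F, hx, hy, dif_neg, not_false_iff, Sum.inr.injEq, Subtype.mk.injEq]
        refine ⟨fun h => ?_, fun h => h ▸ SameCycle.refl _ _⟩
        exact h.eq_of_left (notMem_support.mp hx)
  have surj : Function.Surjective F := by
    rintro (⟨c, hc⟩ | ⟨x, hx⟩)
    · obtain ⟨x, hx⟩ := (mem_cycleFactorsFinset_iff.mp hc).1.nonempty_support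
      refine ⟨x, ?_⟩
      have h1 : x ∈ σ.support := mem_cycleFactorsFinset_support_le hc hx
      simp only [F, h1, dif_pos, Sum.inl.injEq, Subtype.mk.injEq]
      exact (cycle_is_cycleOf hx hc).symm
    · exact ⟨x, dif_neg hx⟩
  have e : numClasses (orbitSetoid {σ}) =
      Nat.card (σ.cycleFactorsFinset ⊕ {x // x ∉ σ.support}) := by
    have hs : orbitSetoid {σ} = Setoid.ker F := by
      ext x y
      rw [orbitSetoid_singleton_apply, key]; rfl
    rw [numClasses, hs]
    exact Nat.card_congr (Setoid.quotientKerEquivOfSurjective F surj)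
  have h1 : Nat.card {x // x ∉ σ.support} + σ.support.card = Fintype.card D := by
    have := Finset.card_compl_add_card σ.support
    rw [← this]
    simp [Nat.card_eq_fintype_card, Fintype.card_subtype, Finset.compl_eq_univ_sdiff,
      Finset.sdiff_eq_filter]
  rw [e, Nat.card_sum, add_assoc, h1]
  simp [cycleType_def]

lemma sign_eq_neg_one_pow (σ : Perm D) :
    sign σ = (-1) ^ (Fintype.card D + numClasses (orbitSetoid {σ})) := by
  have h := numClasses_orbitSetoid_singleton σ
  rw [sign_of_cycleType, sum_cycleType]
  have : Fintype.card D + numClasses (orbitSetoid {σ}) + 2 * σ.support.card =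
      σ.support.card + σ.cycleType.card + 2 * Fintype.card D := by omega
  have h2 := congrArg (fun k => (-1 : ℤˣ) ^ k) this
  simpa [pow_add, pow_mul] using h2.symm

lemma even_add_numClasses_mul (σ τ : Perm D) :
    Even (Fintype.card D + numClasses (orbitSetoid {σ}) + numClasses (orbitSetoid {τ}) +
      numClasses (orbitSetoid {σ * τ})) := by
  have h := sign_mul σ τ
  simp only [sign_eq_neg_one_pow, ← pow_add] at h
  have h2 : (-1 : ℤˣ) ^ (Fintype.card D + numClasses (orbitSetoid {σ}) +
      numClasses (orbitSetoid {τ}) + numClasses (orbitSetoid {σ * τ}) + 2 * Fintype.card D) = 1 := by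
    rw [show Fintype.card D + numClasses (orbitSetoid {σ}) + numClasses (orbitSetoid {τ}) +
        numClasses (orbitSetoid {σ * τ}) + 2 * Fintype.card D =
        (Fintype.card D + numClasses (orbitSetoid {σ * τ})) +
        (Fintype.card D + numClasses (orbitSetoid {σ}) +
          (Fintype.card D + numClasses (orbitSetoid {τ}))) by ring, pow_add, ← h, ← pow_add]
    exact Even.neg_one_pow ⟨_, rfl⟩
  rw [neg_one_pow_eq_one_iff_even (by decide)] at h2
  exact (Nat.even_add.mp h2).mpr (even_two_mul _)

end Parity

section MulSwap

variable [Finite D] [DecidableEq D] {σ : Perm D} {a b : D}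

/-- By its sign, multiplying by a transposition changes the parity of the number of cycles. As the
numbers before and after agree once `a` and `b` are identified, they differ by exactly one. -/
lemma odd_numClasses_add_mul_swap (hab : a ≠ b) :
    Odd (numClasses (orbitSetoid {σ}) + numClasses (orbitSetoid {σ * swap a b})) := by
  have := Fintype.ofFinite D
  have h1 := sign_eq_neg_one_pow (σ * swap a b)
  rw [Equiv.Perm.sign_mul, sign_swap hab, sign_eq_neg_one_pow σ] at h1
  have h2 : (-1 : ℤˣ) ^ (numClasses (orbitSetoid {σ}) +
      numClasses (orbitSetoid {σ * swap a b})) = -1 := by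
    rw [pow_add, pow_add, mul_assoc] at h1
    rw [pow_add, ← mul_left_cancel h1]
    rw [← mul_assoc, ← pow_add, Even.neg_one_pow ⟨_, rfl⟩, one_mul]
  rwa [neg_one_pow_eq_neg_one_iff_odd (by decide)] at h2

/-- Multiplying by a transposition of two points of one cycle splits this cycle. -/
lemma numClasses_mul_swap_of_sameCycle (hab : a ≠ b) (h : SameCycle σ a b) :
    numClasses (orbitSetoid {σ * swap a b}) = numClasses (orbitSetoid {σ}) + 1 := by
  have hodd := odd_numClasses_add_mul_swap (σ := σ) hab
  have e := sup_swap_mul_swap σ a b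
  rw [sup_swap_eq_of_rel (s := orbitSetoid {σ}) ((orbitSetoid_singleton_apply _ _ _).mpr h)] at e
  by_cases h' : orbitSetoid {σ * swap a b} a b
  · rw [sup_swap_eq_of_rel h'] at e
    rw [e] at hodd
    exact absurd ⟨_, rfl⟩ (Nat.not_even_iff_odd.mpr hodd)
  · rw [← numClasses_sup_swap h', e]

/-- Multiplying by a transposition of points of two different cycles joins these cycles. -/
lemma numClasses_mul_swap_of_not_sameCycle (h : ¬ SameCycle σ a b) :
    numClasses (orbitSetoid {σ * swap a b}) + 1 = numClasses (orbitSetoid {σ}) := by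
  have hab : a ≠ b := fun e => h (e ▸ SameCycle.refl _ _)
  have hodd := odd_numClasses_add_mul_swap (σ := σ) hab
  have e := sup_swap_mul_swap σ a b
  have h1 := numClasses_sup_swap (s := orbitSetoid {σ})
    (fun h' => h ((orbitSetoid_singleton_apply _ _ _).mp h'))
  by_cases h' : orbitSetoid {σ * swap a b} a b
  · rw [sup_swap_eq_of_rel h'] at e
    rwa [e]
  · have h2 := numClasses_sup_swap h'
    rw [e] at h2
    rw [← h1, ← h2] at hodd
    exact absurd ⟨_, rfl⟩ (Nat.not_even_iff_odd.mpr hodd)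

end MulSwap

end Orbits

/-! ### The genus of a pair of permutations -/

section Defect

variable {D : Type*}

/-- Twice the total genus of the pair `(σ, α)` of permutations of the finite set `D`, which need not
generate a transitive group: the sum over the orbits `O` of this group of
`2 + |O| - c(σ|O) - c(α|O) - c(σα|O)`, where `c` counts cycles. If `σ` and `α` are the permutations
`next` and `flip` of a polygonal surface, this is `2` minus its Euler characteristic. -/
noncomputable def defect (σ α : Perm D) : ℤ :=
  2 * numClasses (orbitSetoid {σ, α}) + Nat.card D - numClasses (orbitSetoid {σ}) -
    numClasses (orbitSetoid {α}) - numClasses (orbitSetoid {σ * α})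

lemma orbitSetoid_pair_of_left {σ : Perm D} (α : Perm D) {x y : D} (h : SameCycle σ x y) :
    orbitSetoid {σ, α} x y :=
  orbitSetoid_mono (by simp) ((orbitSetoid_singleton_apply _ _ _).mpr h)

lemma orbitSetoid_pair_of_right (σ : Perm D) {α : Perm D} {x y : D} (h : SameCycle α x y) :
    orbitSetoid {σ, α} x y :=
  orbitSetoid_mono (by simp) ((orbitSetoid_singleton_apply _ _ _).mpr h)

lemma orbitSetoid_pair_of_mul {σ α : Perm D} {x y : D} (h : SameCycle (σ * α) x y) :
    orbitSetoid {σ, α} x y := by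
  have : orbitSetoid {σ * α} ≤ orbitSetoid {σ, α} := by
    rw [orbitSetoid_le_iff]
    rintro _ rfl z
    exact ⟨σ * α, mul_mem (Subgroup.subset_closure (by simp)) (Subgroup.subset_closure (by simp)),
      rfl⟩
  exact this ((orbitSetoid_singleton_apply _ _ _).mpr h)

/-- Passing to inverses exchanges the roles of `σ` and `α`; this carries statements about `α` over
to `σ`. -/
lemma orbitSetoid_inv_pair (σ α : Perm D) :
    orbitSetoid {α⁻¹, σ⁻¹} = orbitSetoid {σ, α} := by
  apply orbitSetoid_congr
  rw [show ({α⁻¹, σ⁻¹} : Set (Perm D)) = {σ, α}⁻¹ by ext; simp [or_comm]]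
  exact Subgroup.closure_inv _

lemma defect_inv (σ α : Perm D) : defect α⁻¹ σ⁻¹ = defect σ α := by
  unfold defect
  rw [orbitSetoid_inv_pair, ← mul_inv_rev, orbitSetoid_inv, orbitSetoid_inv, orbitSetoid_inv]
  ring

section Swap

variable [DecidableEq D] {σ α : Perm D} {a b : D}

lemma orbitSetoid_mul_swap_sup (σ α : Perm D) (a b : D) :
    orbitSetoid {σ, α * swap a b} ⊔ orbitSetoid {swap a b} =
      orbitSetoid {σ, α} ⊔ orbitSetoid {swap a b} := by
  rw [Set.pair_comm σ, Set.pair_comm σ]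
  exact orbitSetoid_insert_mul_swap_sup {σ} α a b

lemma orbitSetoid_swap_mul (σ α : Perm D) (a b : D) :
    orbitSetoid {swap a b * σ, α} = orbitSetoid {α⁻¹, σ⁻¹ * swap a b} := by
  rw [← orbitSetoid_inv_pair, mul_inv_rev, swap_inv]

variable [Finite D]

lemma sameCycle_mul_swap (h : ¬ SameCycle α a b) : SameCycle (α * swap a b) a b := by
  by_contra h'
  have h1 := numClasses_mul_swap_of_not_sameCycle h
  have h2 := numClasses_mul_swap_of_not_sameCycle h'
  rw [mul_assoc, swap_mul_self, mul_one] at h2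
  omega

lemma orbitSetoid_mul_swap_of_not_rel (h : ¬ orbitSetoid {σ, α} a b) :
    orbitSetoid {σ, α * swap a b} = orbitSetoid {σ, α} ⊔ orbitSetoid {swap a b} := by
  have hα : ¬ SameCycle α a b := fun h' => h (orbitSetoid_pair_of_right σ h')
  rw [← orbitSetoid_mul_swap_sup,
    sup_swap_eq_of_rel (orbitSetoid_pair_of_right σ (sameCycle_mul_swap hα))]

lemma numClasses_mul_swap_of_not_rel (h : ¬ orbitSetoid {σ, α} a b) :
    numClasses (orbitSetoid {σ, α * swap a b}) + 1 = numClasses (orbitSetoid {σ, α}) := by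
  rw [orbitSetoid_mul_swap_of_not_rel h, numClasses_sup_swap h]

/-- Joining two components by a transposition does not change the total genus. -/
lemma defect_mul_swap_of_not_rel (h : ¬ orbitSetoid {σ, α} a b) :
    defect σ (α * swap a b) = defect σ α := by
  have h1 := numClasses_mul_swap_of_not_rel h
  have h2 := numClasses_mul_swap_of_not_sameCycle
    (fun h' => h (orbitSetoid_pair_of_right σ h'))
  have h3 := numClasses_mul_swap_of_not_sameCycle (fun h' => h (orbitSetoid_pair_of_mul h'))
  unfold defect
  rw [← mul_assoc]
  omega

lemma numClasses_swap_mul_of_not_rel (h : ¬ orbitSetoid {σ, α} a b) :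
    numClasses (orbitSetoid {swap a b * σ, α}) + 1 = numClasses (orbitSetoid {σ, α}) := by
  rw [← orbitSetoid_inv_pair σ] at h
  rw [orbitSetoid_swap_mul, numClasses_mul_swap_of_not_rel h, orbitSetoid_inv_pair]

lemma defect_swap_mul_of_not_rel (h : ¬ orbitSetoid {σ, α} a b) :
    defect (swap a b * σ) α = defect σ α := by
  rw [← orbitSetoid_inv_pair σ] at h
  rw [← defect_inv, mul_inv_rev, swap_inv, defect_mul_swap_of_not_rel h, defect_inv]

/-- Deleting an edge, or more generally splitting a cycle of `α`, does not increase the total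
genus. -/
lemma defect_mul_swap_le_of_sameCycle (hab : a ≠ b) (h : SameCycle α a b) :
    defect σ (α * swap a b) ≤ defect σ α := by
  have h1 := numClasses_mul_swap_of_sameCycle hab h
  have hs : orbitSetoid {σ, α * swap a b} ⊔ orbitSetoid {swap a b} = orbitSetoid {σ, α} := by
    rw [orbitSetoid_mul_swap_sup, sup_swap_eq_of_rel (orbitSetoid_pair_of_right σ h)]
  unfold defect
  rw [← mul_assoc]
  by_cases h' : orbitSetoid {σ, α * swap a b} a b
  · rw [sup_swap_eq_of_rel h'] at hs
    rw [hs]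
    by_cases h2 : SameCycle (σ * α) a b
    · have := numClasses_mul_swap_of_sameCycle hab h2
      omega
    · have := numClasses_mul_swap_of_not_sameCycle h2
      omega
  -- if the component falls apart, then `a` and `b` lie in different cycles of
  -- `σ * (α * swap a b)`, and these are joined in `σ * α`
  · have h2 := numClasses_sup_swap h'
    rw [hs] at h2
    have h3 := numClasses_mul_swap_of_not_sameCycle
      (σ := σ * (α * swap a b)) (fun h'' => h' (orbitSetoid_pair_of_mul h''))
    rw [← mul_assoc, mul_assoc, swap_mul_self, mul_one] at h3
    omega

end Swap

section Deletion

lemma numClasses_orbitSetoid_one : numClasses (orbitSetoid {(1 : Perm D)}) = Nat.card D := by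
  have : orbitSetoid {(1 : Perm D)} = ⊥ := by
    rw [eq_bot_iff, orbitSetoid_le_iff]
    rintro _ rfl x
    rfl
  rw [numClasses, this]
  exact Nat.card_congr (Setoid.quotientBotEquiv)

lemma defect_one (σ : Perm D) : defect σ 1 = 0 := by
  have : orbitSetoid {σ, 1} = orbitSetoid {σ} := orbitSetoid_congr (by
    rw [Set.pair_comm, Subgroup.closure_insert_one])
  unfold defect
  rw [this, numClasses_orbitSetoid_one, mul_one]
  ring

variable [Finite D]

/-- Deleting a set of edges does not increase the total genus. -/
lemma defect_le_of_forall_eq_or_eq (σ : Perm D) {α β : Perm D} (hα : ∀ d, α (α d) = d)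
    (hβ : ∀ d, β d = α d ∨ β d = d) : defect σ β ≤ defect σ α := by
  classical
  have := Fintype.ofFinite D
  induction hn : (Finset.univ.filter fun d => β d ≠ α d).card using Nat.strong_induction_on
    generalizing α with | _ n ih
  by_cases h : ∀ d, β d = α d
  · rw [Equiv.ext h]
  push Not at h
  obtain ⟨a, ha⟩ := h
  have hβa : β a = a := (hβ a).resolve_left ha
  have hab : a ≠ α a := fun e => ha (hβa.trans e)
  have hβb : β (α a) = α a := by
    refine (hβ (α a)).resolve_left fun e => hab ?_
    rw [hα] at e
    exact β.injective (hβa.trans e.symm)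
  have happ : ∀ d, (α * swap a (α a)) d = if d = a ∨ d = α a then d else α d := by
    intro d
    by_cases h1 : d = a
    · subst h1; simp [hα]
    by_cases h2 : d = α a
    · subst h2; simp
    · simp [h1, h2, swap_apply_of_ne_of_ne]
  -- `α * swap a (α a)` is `α` with the edge `{a, α a}` deleted
  have hle : defect σ β ≤ defect σ (α * swap a (α a)) := by
    refine ih _ ?_ (α := α * swap a (α a)) ?_ ?_ rfl
    · rw [← hn]
      apply Finset.card_lt_card
      refine ⟨fun d => ?_, fun hsub => ?_⟩
      · simp only [Finset.mem_filter, Finset.mem_univ, true_and, happ]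
        split_ifs with h1
        · rcases h1 with rfl | rfl
          · exact fun h => absurd hβa h
          · exact fun h => absurd hβb h
        · exact id
      · have : a ∈ Finset.univ.filter fun d => β d ≠ α d := by simpa using ha
        have := hsub this
        exact (Finset.mem_filter.mp this).2 (by rw [happ, if_pos (Or.inl rfl), hβa])
    · intro d
      rw [happ, happ]
      split_ifs with h1 h2
      · rfl
      · rcases h2 with h2 | h2
        · exact absurd (Or.inr (by rw [← h2, hα])) h1
        · exact absurd (Or.inl (α.injective h2)) h1
      · exact hα d
    · intro d
      rw [happ]
      split_ifs with h1
      · rcases h1 with rfl | rfl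
        · exact Or.inl hβa
        · exact Or.inl hβb
      · exact hβ d
  exact hle.trans (defect_mul_swap_le_of_sameCycle hab ⟨1, by simp⟩)

/-- Compare with `α = 1`, where all edges have been deleted. -/
lemma defect_nonneg (σ : Perm D) {α : Perm D} (hα : ∀ d, α (α d) = d) : 0 ≤ defect σ α := by
  rw [← defect_one σ]
  exact defect_le_of_forall_eq_or_eq σ hα fun d => Or.inr rfl

/-- Parity of the genus formula: `sign (σ * α) = sign σ * sign α`. -/
lemma even_defect (σ α : Perm D) : Even (defect σ α) := by
  classical
  have := Fintype.ofFinite D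
  have h := even_add_numClasses_mul σ α
  unfold defect
  rw [Nat.card_eq_fintype_card]
  rw [Nat.even_iff] at h
  rw [Int.even_iff]
  omega

end Deletion

section Decomposition

variable {ι : Type*} [Fintype ι] {E : ι → Type*} {e : ∀ i, E i → D}

/-- If `D` is the disjoint union of the images of the `e i`, and the generators `A` act on these
parts through the generators `B i`, then the orbits of `A` are those of the `B i`. -/
lemma numClasses_eq_sum [Finite D]
    (he : Function.Bijective fun x : Σ i, E i => e x.1 x.2) {A : Set (Perm D)}
    {B : ∀ i, Set (Perm (E i))}
    (hA : ∀ g ∈ A, ∃ h : ∀ i, Perm (E i), (∀ i, h i ∈ B i) ∧ ∀ i x, e i (h i x) = g (e i x))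
    (hB : ∀ i, ∀ h ∈ B i, ∃ g ∈ A, ∀ x, e i (h x) = g (e i x)) :
    numClasses (orbitSetoid A) = ∑ i, numClasses (orbitSetoid (B i)) := by
  have hinj : ∀ i, Function.Injective (e i) := fun i x y h => by
    simpa using he.1 (a₁ := ⟨i, x⟩) (a₂ := ⟨i, y⟩) h
  have hfin : ∀ i, Finite (E i) := fun i => Finite.of_injective _ (hinj i)
  have hle : ∀ i, orbitSetoid (B i) ≤ (orbitSetoid A).comap (e i) := by
    intro i
    rw [orbitSetoid_le_iff]
    intro h hh x
    obtain ⟨g, hg, hx⟩ := hB i h hh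
    change orbitSetoid A (e i x) (e i (h x))
    rw [hx]
    exact orbitSetoid_of_mem hg _
  have hclos : ∀ g ∈ Subgroup.closure A, ∃ h : ∀ i, Perm (E i),
      (∀ i, h i ∈ Subgroup.closure (B i)) ∧ ∀ i x, e i (h i x) = g (e i x) := by
    intro g hg
    induction hg using Subgroup.closure_induction with
    | mem g hg =>
      obtain ⟨h, h1, h2⟩ := hA g hg
      exact ⟨h, fun i => Subgroup.subset_closure (h1 i), h2⟩
    | one => exact ⟨fun _ => 1, fun _ => one_mem _, fun _ _ => rfl⟩
    | mul g k _ _ ihg ihk =>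
      obtain ⟨h, h1, h2⟩ := ihg
      obtain ⟨h', h1', h2'⟩ := ihk
      exact ⟨fun i => h i * h' i, fun i => mul_mem (h1 i) (h1' i), fun i x => by simp [h2, h2']⟩
    | inv g _ ih =>
      obtain ⟨h, h1, h2⟩ := ih
      refine ⟨fun i => (h i)⁻¹, fun i => inv_mem (h1 i), fun i x => ?_⟩
      rw [eq_comm, inv_eq_iff_eq, ← h2]
      simp
  let F : (Σ i, Quotient (orbitSetoid (B i))) → Quotient (orbitSetoid A) :=
    fun q => Quotient.map (e q.1) (fun _ _ h => hle q.1 h) q.2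
  have hF : Function.Bijective F := by
    constructor
    · rintro ⟨i, q⟩ ⟨j, q'⟩
      induction q using Quotient.inductionOn with | _ x
      induction q' using Quotient.inductionOn with | _ y
      intro h
      obtain ⟨g, hg, hxy⟩ : orbitSetoid A (e i x) (e j y) := Quotient.exact h
      obtain ⟨k, hk, hk'⟩ := hclos g hg
      rw [← hk'] at hxy
      have := he.1 (a₁ := ⟨i, k i x⟩) (a₂ := ⟨j, y⟩) hxy
      obtain ⟨rfl, h2⟩ := Sigma.mk.inj this
      have h2 := eq_of_heq h2
      have : orbitSetoid (B i) x y := ⟨k i, hk i, h2⟩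
      rw [Quotient.sound this]
    · intro q
      induction q using Quotient.inductionOn with | _ x
      obtain ⟨⟨i, y⟩, rfl⟩ := he.2 x
      exact ⟨⟨i, ⟦y⟧⟩, rfl⟩
  unfold numClasses
  rw [← Nat.card_eq_of_bijective F hF, Nat.card_sigma]

/-- The total genus is additive over a decomposition into invariant parts. -/
lemma defect_eq_sum [Finite D]
    (he : Function.Bijective fun x : Σ i, E i => e x.1 x.2) {σ α : Perm D}
    {s a : ∀ i, Perm (E i)} (hσ : ∀ i x, e i (s i x) = σ (e i x))
    (hα : ∀ i x, e i (a i x) = α (e i x)) : defect σ α = ∑ i, defect (s i) (a i) := by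
  have hinj : ∀ i, Function.Injective (e i) := fun i x y h => by
    simpa using he.1 (a₁ := ⟨i, x⟩) (a₂ := ⟨i, y⟩) h
  have hfin : ∀ i, Finite (E i) := fun i => Finite.of_injective _ (hinj i)
  have hsingle : ∀ {τ : Perm D} {t : ∀ i, Perm (E i)}, (∀ i x, e i (t i x) = τ (e i x)) →
      numClasses (orbitSetoid {τ}) = ∑ i, numClasses (orbitSetoid {t i}) := by
    intro τ t ht
    refine numClasses_eq_sum he ?_ ?_
    · rintro _ rfl
      exact ⟨t, fun i => rfl, ht⟩
    · rintro i _ rfl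
      exact ⟨τ, rfl, ht i⟩
  have hpair : numClasses (orbitSetoid {σ, α}) = ∑ i, numClasses (orbitSetoid {s i, a i}) := by
    refine numClasses_eq_sum he ?_ ?_
    · rintro _ (rfl | rfl)
      · exact ⟨s, fun i => Or.inl rfl, hσ⟩
      · exact ⟨a, fun i => Or.inr rfl, hα⟩
    · rintro i _ (rfl | rfl)
      · exact ⟨σ, Or.inl rfl, hσ i⟩
      · exact ⟨α, Or.inr rfl, hα i⟩
  have hcard : Nat.card D = ∑ i, Nat.card (E i) := by
    rw [← Nat.card_eq_of_bijective _ he, Nat.card_sigma]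
  have hmul : ∀ i x, e i ((s i * a i) x) = (σ * α) (e i x) := fun i x => by simp [hσ, hα]
  unfold defect
  rw [hpair, hcard, hsingle hσ, hsingle hα, hsingle hmul]
  push_cast
  simp only [Finset.sum_sub_distrib, Finset.sum_add_distrib, Finset.mul_sum]

end Decomposition

end Defect

/-! ### Graphs drawn on possibly disconnected surfaces -/

section Drawing

/-- The graph `Γ` is drawn on the possibly disconnected map with vertex permutation `σ` and
edge involution `α`: the vertices of `Γ` lie in distinct cycles of `σ`, and each edge of `Γ` is
realized by a dart. A vertex is recorded by one of the darts in its cycle. A fixed point of `α` is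
a half-edge with a free end. -/
def DrawnOn {V D : Type*} (Γ : SimpleGraph V) (σ α : Perm D) : Prop :=
  ∃ f : V → D, (∀ u v, SameCycle σ (f u) (f v) → u = v) ∧
    ∀ u v, Γ.Adj u v → ∃ d, SameCycle σ (f u) d ∧ SameCycle σ (f v) (α d)

variable {V D : Type*} {Γ : SimpleGraph V} {σ α : Perm D}

lemma DrawnOn.map {D' : Type*} {σ' α' : Perm D'} (h : DrawnOn Γ σ α) (e : D → D')
    (hσ : ∀ x y, SameCycle σ' (e x) (e y) ↔ SameCycle σ x y)
    (hα : ∀ d, α d ≠ d → α' (e d) = e (α d)) : DrawnOn Γ σ' α' := by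
  obtain ⟨f, hf, hadj⟩ := h
  refine ⟨e ∘ f, fun u v huv => hf u v ((hσ _ _).mp huv), fun u v huv => ?_⟩
  obtain ⟨d, hu, hv⟩ := hadj u v huv
  -- a fixed point of `α` would be a loop of `Γ`
  have hd : α d ≠ d := fun h' => huv.ne (hf u v (hu.trans (h' ▸ hv).symm))
  exact ⟨e d, (hσ _ _).mpr hu, by rw [hα d hd]; exact (hσ _ _).mpr hv⟩

section IsolatedDart

lemma orbitSetoid_optionCongr_not_rel (σ α : Perm D) (a : D) :
    ¬ orbitSetoid {optionCongr σ, optionCongr α} (some a) none := by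
  have : orbitSetoid {optionCongr σ, optionCongr α} ≤ Setoid.ker Option.isSome := by
    rw [orbitSetoid_le_iff]
    rintro _ (rfl | rfl) (_ | x) <;> rfl
  intro h
  have h' := this h
  change Option.isSome (some a) = Option.isSome none at h'
  simp at h'

/-- A new dart fixed by both permutations is a sphere with a single vertex and no edges. -/
lemma defect_and_numClasses_optionCongr {D : Type u} [Finite D] (σ α : Perm D) :
    defect (optionCongr σ) (optionCongr α) = defect σ α ∧
    numClasses (orbitSetoid {optionCongr σ, optionCongr α}) =
      numClasses (orbitSetoid {σ, α}) + 1 := by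
  let E : Bool → Type u := fun b => Bool.rec PUnit.{u + 1} D b
  let e : ∀ b, E b → Option D := fun b => Bool.rec (fun _ => none) some b
  let s : Perm D → ∀ b, Perm (E b) := fun τ b => Bool.rec (1 : Perm PUnit.{u + 1}) τ b
  have he : Function.Bijective fun x : Σ b, E b => e x.1 x.2 := by
    constructor
    · rintro ⟨_ | _, x⟩ ⟨_ | _, y⟩ h
      · rfl
      · cases h
      · cases h
      · cases h; rfl
    · rintro (_ | x)
      · exact ⟨⟨false, PUnit.unit⟩, rfl⟩
      · exact ⟨⟨true, x⟩, rfl⟩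
  have hs : ∀ (τ : Perm D) (b : Bool) (x : E b), e b ((s τ b).toFun x) = optionCongr τ (e b x) := by
    rintro τ (_ | _) x <;> rfl
  constructor
  · rw [defect_eq_sum he (hs σ) (hs α), Fintype.sum_bool]
    change defect σ α + defect (1 : Perm PUnit.{u + 1}) 1 = _
    rw [defect_one, add_zero]
  · rw [numClasses_eq_sum he (B := fun b => {s σ b, s α b}), Fintype.sum_bool]
    · change numClasses (orbitSetoid {σ, α}) +
        numClasses (orbitSetoid {(1 : Perm PUnit.{u + 1}), 1}) = _
      rw [Set.pair_eq_singleton, numClasses_orbitSetoid_one]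
      simp
    · rintro _ (rfl | rfl)
      · exact ⟨s σ, fun b => Or.inl rfl, hs σ⟩
      · exact ⟨s α, fun b => Or.inr rfl, hs α⟩
    · rintro b _ (rfl | rfl)
      · exact ⟨_, Or.inl rfl, hs σ b⟩
      · exact ⟨_, Or.inr rfl, hs α b⟩

lemma optionCongr_involutive (hα : ∀ d, α (α d) = d) (z : Option D) :
    optionCongr α (optionCongr α z) = z := by
  cases z <;> simp [hα]

/-- If `τ` acts on the darts of `D` like `σ`, with `none` regarded as lying in the cycle of `a`, then
no cycles of `σ` are joined or split in `τ`. -/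
lemma sameCycle_some_iff {τ : Perm (Option D)} (a : D)
    (h : ∀ z, SameCycle σ (z.getD a) ((τ z).getD a))
    (h' : ∀ x, SameCycle τ (some x) (some (σ x))) (x y : D) :
    SameCycle τ (some x) (some y) ↔ SameCycle σ x y := by
  simp only [← orbitSetoid_singleton_apply] at *
  constructor
  · have : orbitSetoid {τ} ≤ (orbitSetoid {σ}).comap fun z => z.getD a := by
      rw [orbitSetoid_le_iff]
      rintro _ rfl z
      exact h z
    exact fun hxy => this hxy
  · have : orbitSetoid {σ} ≤ (orbitSetoid {τ}).comap some := by
      rw [orbitSetoid_le_iff]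
      rintro _ rfl z
      exact h' z
    exact fun hxy => this hxy

lemma sameCycle_optionCongr (σ : Perm D) (x y : D) :
    SameCycle (optionCongr σ) (some x) (some y) ↔ SameCycle σ x y := by
  refine sameCycle_some_iff x ?_ (fun z => ⟨1, by simp⟩) x y
  rintro (_ | z)
  · exact SameCycle.refl _ _
  · exact ⟨1, by simp⟩

end IsolatedDart

section HalfEdge

variable [DecidableEq D]

/-- The vertex permutation after a new dart `none` has been inserted in front of the dart `a`. -/
def insertDart (σ : Perm D) (a : D) : Perm (Option D) := swap (some a) none * optionCongr σ

lemma insertDart_none (σ : Perm D) (a : D) : insertDart σ a none = some a := by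
  simp [insertDart]

lemma insertDart_some (σ : Perm D) (a x : D) :
    insertDart σ a (some x) = if σ x = a then none else some (σ x) := by
  unfold insertDart
  split_ifs with h
  · simp [h]
  · simp [swap_apply_of_ne_of_ne, h]

lemma sameCycle_getD_insertDart (σ : Perm D) (a : D) (z : Option D) :
    SameCycle σ (z.getD a) ((insertDart σ a z).getD a) := by
  rcases z with _ | z
  · rw [insertDart_none]; exact SameCycle.refl _ _
  · rw [insertDart_some]
    split_ifs with h
    · exact ⟨1, by simp [h]⟩
    · exact ⟨1, by simp⟩

lemma sameCycle_insertDart (σ : Perm D) (a x y : D) :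
    SameCycle (insertDart σ a) (some x) (some y) ↔ SameCycle σ x y := by
  refine sameCycle_some_iff a (sameCycle_getD_insertDart σ a) (fun z => ?_) x y
  by_cases h : σ z = a
  · refine ⟨2, ?_⟩
    rw [zpow_ofNat, pow_two, Perm.mul_apply, insertDart_some, if_pos h, insertDart_none, h]
  · refine ⟨1, ?_⟩
    rw [zpow_one, insertDart_some, if_neg h]

lemma rel_getD_of_insertDart (a : D) {z w : Option D}
    (h : orbitSetoid {insertDart σ a, optionCongr α} z w) :
    orbitSetoid {σ, α} (z.getD a) (w.getD a) := by
  have : orbitSetoid {insertDart σ a, optionCongr α} ≤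
      (orbitSetoid {σ, α}).comap fun z => z.getD a := by
    rw [orbitSetoid_le_iff]
    rintro _ (rfl | rfl) z
    · exact orbitSetoid_pair_of_left α (sameCycle_getD_insertDart σ a z)
    · rcases z with _ | z
      · exact (orbitSetoid {σ, α}).refl a
      · exact orbitSetoid_of_mem (Or.inr rfl) z
  exact this h

variable [Finite D]

lemma defect_insertDart (σ α : Perm D) (a : D) :
    defect (insertDart σ a) (optionCongr α) = defect σ α := by
  rw [insertDart, defect_swap_mul_of_not_rel (orbitSetoid_optionCongr_not_rel σ α a),
    (defect_and_numClasses_optionCongr σ α).1]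

lemma numClasses_insertDart (σ α : Perm D) (a : D) :
    numClasses (orbitSetoid {insertDart σ a, optionCongr α}) =
      numClasses (orbitSetoid {σ, α}) := by
  have h := numClasses_swap_mul_of_not_rel (orbitSetoid_optionCongr_not_rel σ α a)
  rw [(defect_and_numClasses_optionCongr σ α).2] at h
  exact Nat.succ_injective h

end HalfEdge

/-- Half-edges are inserted at two components and joined to an edge, until only one component is
left. -/
lemma DrawnOn.exists_transitive {D : Type} [Finite D] {σ α : Perm D} (h : DrawnOn Γ σ α)
    (hα : ∀ d, α (α d) = d) {n : ℕ} (hn : numClasses (orbitSetoid {σ, α}) = n + 1) :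
    ∃ (D' : Type) (_ : Finite D') (σ' α' : Perm D'), (∀ d, α' (α' d) = d) ∧ DrawnOn Γ σ' α' ∧
      defect σ' α' = defect σ α ∧ numClasses (orbitSetoid {σ', α'}) = 1 := by
  classical
  induction n generalizing D with
  | zero => exact ⟨D, inferInstance, σ, α, hα, h, rfl, hn⟩
  | succ n ih =>
    have : Nontrivial (Quotient (orbitSetoid {σ, α})) := by
      rw [← Finite.one_lt_card_iff_nontrivial]
      change 1 < numClasses _
      omega
    obtain ⟨q, q', hq⟩ := exists_pair_ne (Quotient (orbitSetoid {σ, α}))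
    induction q using Quotient.inductionOn with | _ x
    induction q' using Quotient.inductionOn with | _ y
    have hxy : ¬ orbitSetoid {σ, α} x y := fun h' => hq (Quotient.sound h')
    set σ₂ := insertDart (insertDart σ x) (some y)
    set α₂ : Perm (Option (Option D)) := optionCongr (optionCongr α)
    have hrel : ¬ orbitSetoid {σ₂, α₂} (some none) none := fun h' =>
      hxy (rel_getD_of_insertDart x (rel_getD_of_insertDart (some y) h'))
    have hfix1 : α₂ (some none) = some none := rfl
    have hfix2 : α₂ none = none := rfl
    have hα₂ : ∀ d, α₂ (α₂ d) = d := optionCongr_involutive (optionCongr_involutive hα)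
    have hne : ∀ {z : Option (Option D)}, z ≠ some none → z ≠ none →
        (α₂ * swap (some none) none : Perm (Option (Option D))) z = α₂ z := by
      intro z h1 h2
      rw [Perm.mul_apply, swap_apply_of_ne_of_ne h1 h2]
    have hd : defect σ₂ (α₂ * swap (some none) none) = defect σ α := by
      rw [defect_mul_swap_of_not_rel hrel, defect_insertDart, defect_insertDart]
    have hc : numClasses (orbitSetoid {σ₂, α₂ * swap (some none) none}) = n + 1 := by
      have := numClasses_mul_swap_of_not_rel hrel
      rw [numClasses_insertDart, numClasses_insertDart, hn] at this
      omega
    rw [← hd]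
    refine ih ?_ ?_ hc
    · refine h.map (fun d => some (some d)) (fun z w => ?_) (fun d _ => ?_)
      · rw [sameCycle_insertDart, sameCycle_insertDart]
      · rw [hne (by simp) (by simp)]
        rfl
    · intro z
      by_cases h1 : z = some none
      · subst h1; simp [hfix1, hfix2]
      by_cases h2 : z = none
      · subst h2; simp [hfix1, hfix2]
      · rw [hne h1 h2, hne, hα₂]
        · intro h3; exact h1 (by rw [← hα₂ z, h3, hfix1])
        · intro h3; exact h2 (by rw [← hα₂ z, h3, hfix2])

/-- A half-edge is closed without changing the genus, by putting a new vertex at its free end. -/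
lemma DrawnOn.exists_fixedPointFree {D : Type} [Finite D] {σ α : Perm D} (h : DrawnOn Γ σ α)
    (hα : ∀ d, α (α d) = d) (hc : numClasses (orbitSetoid {σ, α}) = 1) :
    ∃ (D' : Type) (_ : Finite D') (σ' α' : Perm D'), (∀ d, α' (α' d) = d) ∧ (∀ d, α' d ≠ d) ∧
      DrawnOn Γ σ' α' ∧ defect σ' α' = defect σ α ∧ numClasses (orbitSetoid {σ', α'}) = 1 := by
  classical
  induction hn : {d | α d = d}.ncard using Nat.strong_induction_on generalizing D with | _ n ih
  by_cases hfix : ∀ d, α d ≠ d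
  · exact ⟨D, inferInstance, σ, α, hα, hfix, h, rfl, hc⟩
  push Not at hfix
  obtain ⟨a, ha⟩ := hfix
  have hrel := orbitSetoid_optionCongr_not_rel σ α a
  set β : Perm (Option D) := optionCongr α * swap (some a) none
  have hβa : β (some a) = none := by simp [β]
  have hβn : β none = some a := by simp [β, ha]
  have hβ : ∀ {d}, d ≠ a → β (some d) = some (α d) := by
    intro d hd
    simp [β, swap_apply_of_ne_of_ne, hd]
  have hd : defect (optionCongr σ) β = defect σ α := by
    rw [defect_mul_swap_of_not_rel hrel, (defect_and_numClasses_optionCongr σ α).1]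
  have hc' : numClasses (orbitSetoid {optionCongr σ, β}) = 1 := by
    have := numClasses_mul_swap_of_not_rel hrel
    rw [(defect_and_numClasses_optionCongr σ α).2, hc] at this
    exact Nat.succ_injective this
  rw [← hd]
  refine ih _ ?_ ?_ ?_ hc' rfl
  · have hsub : {z | β z = z} ⊆ some '' ({d | α d = d} \ {a}) := by
      rintro (_ | d) hz
      · rw [Set.mem_ofPred_eq, hβn] at hz
        cases hz
      · by_cases hda : d = a
        · subst hda
          rw [Set.mem_ofPred_eq, hβa] at hz
          cases hz
        · rw [Set.mem_ofPred_eq, hβ hda] at hz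
          exact ⟨d, ⟨Option.some_injective _ hz, hda⟩, rfl⟩
    calc _ ≤ (some '' ({d | α d = d} \ {a})).ncard := Set.ncard_le_ncard hsub (Set.toFinite _)
      _ = ({d | α d = d} \ {a}).ncard := Set.ncard_image_of_injective _ (Option.some_injective _)
      _ < n := hn ▸ Set.ncard_sdiff_singleton_lt_of_mem ha (Set.toFinite _)
  · refine h.map some (sameCycle_optionCongr σ) fun d hne => hβ ?_
    rintro rfl
    exact hne ha
  · rintro (_ | d)
    · rw [hβn, hβa]
    · by_cases hda : d = a
      · rw [hda, hβa, hβn]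
      · rw [hβ hda, hβ, hα]
        intro h'
        rw [← h', hα] at ha
        exact hda (ha.trans h')

/-- In a fixed-point-free involution all cycles have length two. -/
lemma two_mul_numClasses_of_fixedPointFree [Finite D] (hα : ∀ d, α (α d) = d)
    (hα' : ∀ d, α d ≠ d) : 2 * numClasses (orbitSetoid {α}) = Nat.card D := by
  classical
  have := Fintype.ofFinite D
  have h := numClasses_orbitSetoid_singleton α
  have hsupp : α.support = Finset.univ := by
    ext d; simp [hα' d]
  have h2 : ∀ n ∈ α.cycleType, n = 2 := by
    have hsq : α ^ 2 = 1 := by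
      ext d; simp [pow_two, hα]
    intro n hn
    have h3 := (dvd_of_mem_cycleType hn).trans (orderOf_dvd_of_pow_eq_one hsq)
    exact le_antisymm (Nat.le_of_dvd two_pos h3) (two_le_of_mem_cycleType hn)
  have h4 := sum_cycleType α
  rw [Multiset.eq_replicate_card.mpr h2, Multiset.sum_replicate, hsupp, Finset.card_univ] at h4
  rw [hsupp, Finset.card_univ] at h
  rw [Nat.card_eq_fintype_card, ← h4, smul_eq_mul]
  omega

/-- Since `flip` has no fixed points, there are twice as many darts as edges. -/
lemma _root_.PolygonalSurface.defect_eq (S : PolygonalSurface) :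
    defect S.next S.flip = 2 - S.eulerChar := by
  have := S.finite
  have := S.nonempty
  have hE := two_mul_numClasses_of_fixedPointFree S.flip_flip S.flip_ne
  have h1 : numClasses (orbitSetoid {S.next, S.flip}) = 1 := by
    rw [numClasses, Nat.card_eq_one_iff_unique]
    refine ⟨⟨fun q q' => ?_⟩, ⟨⟦Classical.arbitrary _⟧⟩⟩
    induction q using Quotient.inductionOn with | _ x
    induction q' using Quotient.inductionOn with | _ y
    exact Quotient.sound (S.connected x y)
  have hV : Nat.card S.Vertex = numClasses (orbitSetoid {S.next}) := by
    rw [orbitSetoid_singleton]; rfl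
  have hEd : Nat.card S.Edge = numClasses (orbitSetoid {S.flip}) := by
    rw [orbitSetoid_singleton]; rfl
  have hF : Nat.card S.Face = numClasses (orbitSetoid {S.next * S.flip}) := by
    rw [orbitSetoid_singleton]; rfl
  unfold defect PolygonalSurface.eulerChar
  rw [h1, hV, hEd, hF]
  omega

lemma _root_.PolygonalSurface.source_eq_iff (S : PolygonalSurface) (x y : S.Dart) :
    S.source x = S.source y ↔ SameCycle S.next x y :=
  Quotient.eq (r := SameCycle.setoid S.next)

/-- A drawing of defect `2 n` gives an embedding on the sphere with `n` handles. -/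
lemma DrawnOn.embeds {D : Type} [Finite D] [Nonempty D] {σ α : Perm D} (h : DrawnOn Γ σ α)
    (hα : ∀ d, α (α d) = d) {n : ℕ} (hn : defect σ α = 2 * n) :
    EmbedsOnSphereWithHandles Γ n := by
  have : Nonempty (Quotient (orbitSetoid {σ, α})) := ⟨⟦Classical.arbitrary D⟧⟩
  obtain ⟨k, hk⟩ : ∃ k, numClasses (orbitSetoid {σ, α}) = k + 1 :=
    Nat.exists_eq_succ_of_ne_zero (Nat.card_pos (α := Quotient (orbitSetoid {σ, α}))).ne'
  obtain ⟨D₁, _, σ₁, α₁, hα₁, h₁, hd₁, hc₁⟩ := h.exists_transitive hα hk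
  obtain ⟨D₂, _, σ₂, α₂, hα₂, hα₂', ⟨f, hf, hadj⟩, hd₂, hc₂⟩ := h₁.exists_fixedPointFree hα₁ hc₁
  obtain ⟨hsub, ⟨q⟩⟩ := Nat.card_eq_one_iff_unique.mp hc₂
  let S : PolygonalSurface :=
    { Dart := D₂
      finite := inferInstance
      nonempty := ⟨q.out⟩
      next := σ₂
      flip := α₂
      flip_flip := hα₂
      flip_ne := hα₂'
      connected := fun d e => Quotient.exact (hsub.elim ⟦d⟧ ⟦e⟧) }
  refine ⟨S, ?_, fun v => S.source (f v), fun u v huv => hf u v ((S.source_eq_iff _ _).mp huv),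
    fun u v huv => ?_⟩
  · have hS : defect S.next S.flip = 2 * n := by rw [← hn, ← hd₁, ← hd₂]
    rw [S.defect_eq] at hS
    omega
  · obtain ⟨d, h1, h2⟩ := hadj u v huv
    exact ⟨d, (S.source_eq_iff _ _).mpr h1.symm, (S.source_eq_iff _ _).mpr h2.symm⟩

lemma drawnOn_of_embeds {n : ℕ} (h : EmbedsOnSphereWithHandles Γ n) :
    ∃ (D : Type) (_ : Finite D) (_ : Nonempty D) (σ α : Perm D), (∀ d, α (α d) = d) ∧
      DrawnOn Γ σ α ∧ defect σ α = 2 * n := by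
  obtain ⟨S, hS, f, hf, hadj⟩ := h
  have hout : ∀ v, ∃ d, S.source d = f v := fun v => Quotient.exists_rep (f v)
  choose F hF using hout
  refine ⟨S.Dart, S.finite, S.nonempty, S.next, S.flip, S.flip_flip, ⟨F, fun u v huv => ?_,
    fun u v huv => ?_⟩, ?_⟩
  · apply hf
    rw [← hF, ← hF, S.source_eq_iff]
    exact huv
  · obtain ⟨d, h1, h2⟩ := hadj u v huv
    rw [← hF, S.source_eq_iff] at h1 h2
    exact ⟨d, h1.symm, h2.symm⟩
  · rw [S.defect_eq, hS]
    ring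

end Drawing

/-! ### Additivity of the genus -/

section Genus

lemma embeds_of_hom {V W : Type*} {Γ : SimpleGraph V} {Γ' : SimpleGraph W} (f : Γ →g Γ')
    (hf : Function.Injective f) {n : ℕ} (h : EmbedsOnSphereWithHandles Γ' n) :
    EmbedsOnSphereWithHandles Γ n := by
  obtain ⟨S, hS, g, hg, hadj⟩ := h
  exact ⟨S, hS, g ∘ f, hg.comp hf, fun u v huv => hadj _ _ (f.map_adj huv)⟩

lemma graphGenus_congr {V W : Type*} {Γ : SimpleGraph V} {Γ' : SimpleGraph W} (f : Γ ≃g Γ') :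
    graphGenus Γ = graphGenus Γ' := by
  unfold graphGenus
  congr 1
  ext n
  exact ⟨embeds_of_hom f.symm.toHom f.symm.injective, embeds_of_hom f.toHom f.injective⟩

lemma exists_nat_defect_eq {D : Type*} [Finite D] (σ : Perm D) {α : Perm D}
    (hα : ∀ d, α (α d) = d) : ∃ n : ℕ, defect σ α = 2 * n := by
  obtain ⟨m, hm⟩ := even_defect σ α
  have := defect_nonneg σ hα
  exact ⟨m.toNat, by omega⟩

/-- In the complete graph on `Fin (k + 1)`, every cyclic order of the darts around the vertices
defines a surface. -/
lemma exists_embeds_top (k : ℕ) :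
    ∃ n, EmbedsOnSphereWithHandles (⊤ : SimpleGraph (Fin (k + 1))) n := by
  -- `(u, v)` is the dart from `u` to `v`; `(u, u)` is a half-edge
  let σ : Perm (Fin (k + 1) × Fin (k + 1)) := prodCongr (Equiv.refl _) (Equiv.addRight 1)
  let α : Perm (Fin (k + 1) × Fin (k + 1)) := prodComm _ _
  have hα : ∀ d, α (α d) = d := fun _ => rfl
  obtain ⟨n, hn⟩ := exists_nat_defect_eq σ hα
  have hfst : ∀ x y, SameCycle σ x y → x.1 = y.1 := by
    have : orbitSetoid {σ} ≤ Setoid.ker Prod.fst := by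
      rw [orbitSetoid_le_iff]
      rintro _ rfl x
      rfl
    exact fun x y h => this ((orbitSetoid_singleton_apply _ _ _).mpr h)
  have hrow : ∀ u v, SameCycle σ (u, 0) (u, v) := by
    intro u v
    induction v using Fin.induction with
    | zero => exact SameCycle.refl _ _
    | succ i ih =>
      refine ih.trans ⟨1, ?_⟩
      rw [zpow_one]
      change (u, i.castSucc + 1) = (u, i.succ)
      rw [Fin.coeSucc_eq_succ]
  have h : DrawnOn (⊤ : SimpleGraph (Fin (k + 1))) σ α :=
    ⟨fun u => (u, 0), fun u v h => hfst _ _ h, fun u v _ => ⟨(u, v), hrow u v, hrow v u⟩⟩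
  exact ⟨n, h.embeds hα hn⟩

lemma exists_embeds {V : Type*} [Finite V] [Nonempty V] (Γ : SimpleGraph V) :
    ∃ n, EmbedsOnSphereWithHandles Γ n := by
  obtain ⟨k, ⟨e⟩⟩ := Finite.exists_equiv_fin V
  obtain ⟨k, rfl⟩ : ∃ m, k = m + 1 :=
    Nat.exists_eq_succ_of_ne_zero (by rintro rfl; exact (e (Classical.arbitrary V)).elim0)
  obtain ⟨n, hn⟩ := exists_embeds_top k
  exact ⟨n, embeds_of_hom ⟨e, fun h => fun h' => h.ne (e.injective h')⟩ e.injective hn⟩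

/-- The infimum in `graphGenus` is attained. -/
lemma embeds_graphGenus {V : Type*} [Finite V] [Nonempty V] (Γ : SimpleGraph V) :
    EmbedsOnSphereWithHandles Γ (graphGenus Γ) :=
  Nat.sInf_mem (s := {n | EmbedsOnSphereWithHandles Γ n}) (exists_embeds Γ)

lemma graphGenus_le {V : Type*} {Γ : SimpleGraph V} {n : ℕ}
    (h : EmbedsOnSphereWithHandles Γ n) : graphGenus Γ ≤ n :=
  Nat.sInf_le h

section Additivity

variable {V : Type*} {Γ : SimpleGraph V} {ι : Type} [Fintype ι] {p : V → ι}

/-- The connected sum of surfaces for the parts of `Γ`. -/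
lemma embeds_sum [Nonempty ι] (hadj : ∀ u v, Γ.Adj u v → p u = p v) {n : ι → ℕ}
    (h : ∀ i, EmbedsOnSphereWithHandles (Γ.induce {v | p v = i}) (n i)) :
    EmbedsOnSphereWithHandles Γ (∑ i, n i) := by
  choose D hfin hne s a ha hdr hd using fun i => drawnOn_of_embeds (h i)
  choose f hf hadj' using hdr
  let σ : Perm (Σ i, D i) := Equiv.sigmaCongrRight s
  let α : Perm (Σ i, D i) := Equiv.sigmaCongrRight a
  have hα : ∀ d, α (α d) = d := by
    rintro ⟨i, d⟩
    exact congrArg (Sigma.mk i) (ha i d)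
  have hpow : ∀ (k : ℤ) i (x : D i), (σ ^ k) ⟨i, x⟩ = ⟨i, (s i ^ k) x⟩ := by
    intro k i x
    have : σ ^ k = Equiv.sigmaCongrRight (s ^ k) :=
      (map_zpow (Equiv.Perm.sigmaCongrRightHom D) s k).symm
    rw [this]
    rfl
  have hsame : ∀ i (x y : D i), SameCycle (s i) x y → SameCycle σ ⟨i, x⟩ ⟨i, y⟩ := by
    rintro i x _ ⟨k, rfl⟩
    exact ⟨k, hpow k i x⟩
  let F : V → Σ i, D i := fun v => ⟨p v, f (p v) ⟨v, rfl⟩⟩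
  have hF : ∀ i (v : {v | p v = i}), F v = ⟨i, f i v⟩ := by
    rintro _ ⟨v, rfl⟩
    rfl
  have hdraw : DrawnOn Γ σ α := by
    refine ⟨F, fun u v huv => ?_, fun u v huv => ?_⟩
    · obtain ⟨k, hk⟩ := huv
      have hp : p u = p v := by
        have := congrArg Sigma.fst hk
        rwa [hpow] at this
      rw [hF (p v) ⟨u, hp⟩, hF (p v) ⟨v, rfl⟩, hpow] at hk
      exact congrArg Subtype.val (hf (p v) ⟨u, hp⟩ ⟨v, rfl⟩ ⟨k, eq_of_heq (Sigma.mk.inj hk).2⟩)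
    · have hp := hadj u v huv
      obtain ⟨d, h1, h2⟩ := hadj' (p v) ⟨u, hp⟩ ⟨v, rfl⟩ huv
      refine ⟨⟨p v, d⟩, ?_, ?_⟩
      · rw [hF (p v) ⟨u, hp⟩]
        exact hsame _ _ _ h1
      · exact hsame _ _ _ h2
  have : Nonempty (Σ i, D i) := ⟨⟨Classical.arbitrary ι, Classical.choice (hne _)⟩⟩
  refine hdraw.embeds hα ?_
  rw [defect_eq_sum (ι := ι) (E := D) (e := fun i x => ⟨i, x⟩) (s := s) (a := a)
    Function.bijective_id (fun _ _ => rfl) (fun _ _ => rfl)]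
  simp [hd, Finset.mul_sum]

/-- Cut an embedding of `Γ` into embeddings of its parts, by deleting all edges which do not join
two vertices of one part. -/
lemma sum_graphGenus_le (hp : Function.Surjective p) {n : ℕ}
    (h : EmbedsOnSphereWithHandles Γ n) :
    ∑ i, graphGenus (Γ.induce {v | p v = i}) ≤ n := by
  classical
  obtain ⟨D, _, _, σ, α, hα, ⟨f, hf, hdart⟩, hd⟩ := drawnOn_of_embeds h
  -- the part to which the initial vertex of a dart belongs, if it is a vertex of `Γ`
  obtain ⟨ℓ, hℓσ, hℓf⟩ : ∃ ℓ : D → Option ι, (∀ x y, SameCycle σ x y → ℓ x = ℓ y) ∧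
      ∀ v, ℓ (f v) = some (p v) := by
    refine ⟨fun d => if h : ∃ v, SameCycle σ (f v) d then some (p h.choose) else none, ?_, ?_⟩
    · intro x y hxy
      have : ∀ v, SameCycle σ (f v) x ↔ SameCycle σ (f v) y :=
        fun v => ⟨fun h => h.trans hxy, fun h => h.trans hxy.symm⟩
      simp only [this]
    · intro v
      have h : ∃ u, SameCycle σ (f u) (f v) := ⟨v, SameCycle.refl _ _⟩
      change dite _ _ _ = _
      rw [dif_pos h, hf _ _ h.choose_spec]
  have hβinv : Function.Involutive fun d => if ℓ (α d) = ℓ d then α d else d := by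
    intro d
    by_cases h : ℓ (α d) = ℓ d
    · simp [h, hα]
    · simp [h]
  let β : Perm D := hβinv.toPerm
  have hβ : ∀ d, β d = if ℓ (α d) = ℓ d then α d else d := fun _ => rfl
  have hℓβ : ∀ d, ℓ (β d) = ℓ d := by
    intro d
    rw [hβ]
    split_ifs with h
    · exact h
    · rfl
  have hle : defect σ β ≤ 2 * n := by
    rw [← hd]
    refine defect_le_of_forall_eq_or_eq σ hα fun d => ?_
    rw [hβ]
    split_ifs <;> simp
  have hσ' : ∀ d, ℓ (σ d) = ℓ d := fun d => hℓσ _ _ ⟨-1, by simp⟩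
  let s : ∀ j, Perm {d // ℓ d = j} := fun j => σ.subtypePerm fun d => by rw [hσ']
  let b : ∀ j, Perm {d // ℓ d = j} := fun j => β.subtypePerm fun d => by rw [hℓβ]
  have hb : ∀ j d, b j (b j d) = d := fun j d => Subtype.ext (hβinv d.1)
  have hsum : defect σ β = ∑ j, defect (s j) (b j) :=
    defect_eq_sum (ι := Option ι) (E := fun j => {d // ℓ d = j}) (e := fun j d => d.1)
      (Equiv.sigmaFiberEquiv ℓ).bijective (fun _ _ => rfl) (fun _ _ => rfl)
  -- the darts with label `none` are discarded; their defect is nonnegative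
  have hpart : ∀ i, (2 * graphGenus (Γ.induce {v | p v = i}) : ℤ) ≤
      defect (s (some i)) (b (some i)) := by
    intro i
    obtain ⟨m, hm⟩ := exists_nat_defect_eq (s (some i)) (hb (some i))
    let F : {v | p v = i} → {d // ℓ d = some i} := fun v => ⟨f v.1, by rw [hℓf, v.2]⟩
    obtain ⟨v, hv⟩ := hp i
    have : Nonempty {d // ℓ d = some i} := ⟨F ⟨v, hv⟩⟩
    have hdraw : DrawnOn (Γ.induce {v | p v = i}) (s (some i)) (b (some i)) := by
      refine ⟨F, fun u v huv => Subtype.ext (hf _ _ (sameCycle_subtypePerm.mp huv)),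
        fun u v huv => ?_⟩
      obtain ⟨d, h1, h2⟩ := hdart u.1 v.1 huv
      have hd1 : ℓ d = some i := by rw [← hℓσ _ _ h1, hℓf, u.2]
      have hd2 : ℓ (α d) = some i := by rw [← hℓσ _ _ h2, hℓf, v.2]
      refine ⟨⟨d, hd1⟩, sameCycle_subtypePerm.mpr h1, sameCycle_subtypePerm.mpr ?_⟩
      change SameCycle σ (f v) (β d)
      rwa [hβ, if_pos (hd2.trans hd1.symm)]
    rw [hm]
    exact_mod_cast Nat.mul_le_mul_left 2 (graphGenus_le (hdraw.embeds (hb _) hm))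
  rw [hsum, Fintype.sum_option] at hle
  have h0 := defect_nonneg (s none) (hb none)
  have h1 := Finset.sum_le_sum fun i (_ : i ∈ Finset.univ) => hpart i
  rw [← Finset.mul_sum] at h1
  zify
  omega

/-- The genus of a disjoint union of graphs is the sum of their genera. -/
theorem graphGenus_eq_sum [Finite V] [Nonempty V] (hp : Function.Surjective p)
    (hadj : ∀ u v, Γ.Adj u v → p u = p v) :
    graphGenus Γ = ∑ i, graphGenus (Γ.induce {v | p v = i}) := by
  have : Nonempty ι := ⟨p (Classical.arbitrary V)⟩
  refine le_antisymm (graphGenus_le (embeds_sum hadj fun i => ?_))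
    (sum_graphGenus_le hp (embeds_graphGenus Γ))
  obtain ⟨v, hv⟩ := hp i
  have : Nonempty {v | p v = i} := ⟨⟨v, hv⟩⟩
  exact embeds_graphGenus _

end Additivity

end Genus

end CombinatorialMap

/-! ### Centralizers in AC-groups -/


section ACGroup

variable {G : Type*} [Group G]

lemma IsACGroup.centralizer_sdiff_eq_iff (hAC : IsACGroup G) {u v : G}
    (hu : u ∉ Subgroup.center G) (hv : v ∉ Subgroup.center G) :
    (Subgroup.centralizer {u} : Set G) \ (Subgroup.center G : Set G) =
      (Subgroup.centralizer {v} : Set G) \ (Subgroup.center G : Set G) ↔ u * v = v * u := by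
  have mem : ∀ x y : G, x ∈ Subgroup.centralizer {y} ↔ y * x = x * y := fun x y =>
    Subgroup.mem_centralizer_singleton_iff.trans eq_comm
  constructor
  · intro h
    have : u ∈ (Subgroup.centralizer {u} : Set G) \ (Subgroup.center G : Set G) :=
      ⟨(mem u u).mpr rfl, hu⟩
    rw [h] at this
    exact ((mem u v).mp this.1).symm
  · intro h
    ext x
    refine and_congr_left fun _ => ⟨fun hx => ?_, fun hx => ?_⟩
    · exact (mem x v).mpr (hAC u hu v ((mem v u).mpr h) x hx)
    · exact (mem x u).mpr (hAC v hv u ((mem u v).mpr h.symm) x hx)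

end ACGroup

theorem proposition3p4 {G : Type*} [Group G] [Finite G]
    (hna : ¬ ∀ a b : G, a * b = b * a) (hAC : IsACGroup G) :
    graphGenus (commutingGraph G) =
      ∑ᶠ X ∈ centralizerParts G, graphGenus (⊤ : SimpleGraph (Fin X.ncard)) := by
  classical
  -- the parts are numbered, as the index type of a sum of surfaces has to live in `Type`
  obtain ⟨N, ⟨e⟩⟩ := Finite.exists_equiv_fin (centralizerParts G)
  let q : {x : G // x ∉ Subgroup.center G} → centralizerParts G := fun x =>
    ⟨(Subgroup.centralizer {x.1} : Set G) \ (Subgroup.center G : Set G), x.1, x.2, rfl⟩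
  have hq : ∀ u v, q u = q v ↔ (u : G) * v = v * u := fun u v =>
    Subtype.ext_iff.trans (hAC.centralizer_sdiff_eq_iff u.2 v.2)
  have hqsurj : Function.Surjective q := by
    rintro ⟨_, u, hu, rfl⟩
    exact ⟨⟨u, hu⟩, rfl⟩
  have : Nonempty {x : G // x ∉ Subgroup.center G} := by
    -- otherwise `G` equals its center
    by_contra hempty
    refine hna fun a b => ?_
    have ha : a ∈ Subgroup.center G := by
      by_contra ha
      exact hempty ⟨⟨a, ha⟩⟩
    exact (Subgroup.mem_center_iff.mp ha b).symm
  have hfibre : ∀ X : centralizerParts G, graphGenus ((commutingGraph G).induce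
      {v | e (q v) = e X}) = graphGenus (⊤ : SimpleGraph (Fin X.1.ncard)) := by
    intro X
    obtain ⟨u, rfl⟩ := hqsurj X
    have hmem : ∀ v : {x : G // x ∉ Subgroup.center G}, e (q v) = e (q u) ↔ v.1 ∈ (q u).1 := by
      intro v
      rw [e.apply_eq_iff_eq, hq]
      change _ ↔ v.1 ∈ Subgroup.centralizer {u.1} ∧ v.1 ∉ Subgroup.center G
      rw [Subgroup.mem_centralizer_singleton_iff]
      exact (and_iff_left v.2).symm
    let E : {v | e (q v) = e (q u)} ≃ (q u).1 :=
      { toFun := fun v => ⟨v.1.1, (hmem v.1).mp v.2⟩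
        invFun := fun x => ⟨⟨x.1, x.2.2⟩, (hmem ⟨x.1, x.2.2⟩).mpr x.2⟩
        left_inv := fun _ => rfl
        right_inv := fun _ => rfl }
    let E' : {v | e (q v) = e (q u)} ≃ Fin (q u).1.ncard := E.trans (Finite.equivFin _)
    refine CombinatorialMap.graphGenus_congr ⟨E', fun {v w} => ?_⟩
    have hcomm : (v.1.1 : G) * w.1.1 = w.1.1 * v.1.1 :=
      (hq _ _).mp (e.injective (v.2.trans w.2.symm))
    rw [SimpleGraph.top_adj, E'.injective.ne_iff]
    exact ⟨fun h => ⟨fun h' => h (Subtype.ext h'), hcomm⟩, fun h h' => h.1 (congrArg _ h')⟩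
  have := Fintype.ofFinite (centralizerParts G)
  rw [CombinatorialMap.graphGenus_eq_sum (Γ := commutingGraph G) (p := e ∘ q)
    (e.surjective.comp hqsurj)
    (fun u v huv => congrArg e ((hq u v).mpr huv.2)), ← e.sum_comp,
    ← finsum_set_coe_eq_finsum_mem, finsum_eq_sum_of_fintype]
  exact Finset.sum_congr rfl fun X _ => hfibre X
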